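/- **Conventions.** A *polymatroid* $(E,f)$ is a set $E$ with a function $f:\mathcal P(E)\to\mathbb R$ such that $f(\emptyset)=0$, $f(A)\le f(B)$ for $A\subseteq B$, and $f(A)+f(B)\ge f(A\cup B)+f(A\cap B)$. Write $f(a_1,\dots,a_k)=f(\{a_1,\dots,a_k\})$ and $\mathrm{cl}(A)=\{x\in E: f(A)=f(A\cup\{x\})\}$. It is *of finite type* if $f(A)=\sup\{f(F): F\subseteq A \text{ finite}\}$ for all $A\subseteq E$. It is *entropic* if there are random variables $(X_i)_{i\in E}$ on a finite probability space with $f(A)=H\big((X_i)_{i\in A}\big)$ for all $A\subseteq E$, where $H$ is the Shannon entropy to base $2$. It is *almost entropic* if it is of finite type and is the pointwise limit of a sequence of entropic polymatroids on $E$. A *partial Dowling geometry (PDG) of rank $r$* is a triple $(E,f,S)$ in which $(E,f)$ is a polymatroid and $S$ is a set with an involution $s\mapsto s^{-1}$ and a distinguished element $e=e^{-1}$, such that: * $E$ is the disjoint union of a set $B=\{b_1,\dots,b_r\}$ and of copies $\{s_{i,j}: s\in S\}$ of $S$, one for each $1\le i<j\le r$; for $i<j$ one puts $s_{j,i}:=(s^{-1})_{i,j}$,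 and $s^{-1}_{i,j}:=(s^{-1})_{i,j}$ for all $i\ne j$; * $f(A)=|A|$ for all $A\subseteq B$; * $s_{i,j}\in\mathrm{cl}(\{b_i,b_j\})$, $f(s_{i,j})=1$ and $f(b_i,s_{i,j})=2$ for all $s\in S$ and all distinct $i,j$; * $f(s_{i,j},s^{-1}_{j,k},e_{k,i})=2$ for all $s\in S$ and all distinct $i,j,k$. A triple $(s,s',s'')\in S^3$ is a *relator* if $f(s_{i,j},s'_{j,k},s''_{k,i})=2$ for all distinct $i,j,k$. An element $t\in S$ is a *geometric product* of $s,s'\in S$ if $(s,s',t^{-1})$ is a relator. **Theorem (uniqueness up to parallelism).** Let $(E,f,S)$ be an almost entropic PDG of rank $4$ (that is, $(E,f)$ is almost entropic), and let $s,s'\in S$. 1. If $t,t'\in S$ are both geometric products of $s,s'$, then $f(t_{i,j},t'_{i,j})=1$ for all distinct $1\le i,j\le 4$. 2. Conversely, let $t,t'\in S$. If $t$ is a geometric product of $s,s'$ and $f(t_{i,j},t'_{i,j})=1$ for some distinct $1\le i,j\le 4$, then $t'$ is also a geometric product of $s,s'$. In particular, $f(t_{k,l},t'_{k,l})=1$ for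 all distinct $1\le k,l\le 4$. -/

import Mathlib

open Filter Topology

/-- A polymatroid on the ground set `E`: a normalized, monotone, submodular real-valued function
on the subsets of `E`. -/
structure Polymatroid (E : Type*) where
  rank : Set E → ℝ
  rank_empty : rank ∅ = 0
  rank_mono : ∀ A B : Set E, A ⊆ B → rank A ≤ rank B
  rank_submodular : ∀ A B : Set E, rank (A ∪ B) + rank (A ∩ B) ≤ rank A + rank B

namespace Polymatroid

/-- Finite type: the rank of every set is the supremum of the ranks of its finite subsets
(automatic if `E` is finite). -/
def IsFiniteType {E : Type*} (f : Polymatroid E) : Prop :=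
  ∀ A : Set E, IsLUB (f.rank '' {F : Set E | F ⊆ A ∧ F.Finite}) (f.rank A)

/-- The closure operator of a polymatroid. -/
def cl {E : Type*} (f : Polymatroid E) (A : Set E) : Set E :=
  {x | f.rank A = f.rank (A ∪ {x})}

end Polymatroid

/-- The Shannon entropy (in bits) of a random variable `X` on a finite probability space
`(Ω, P)`. Here `P.map X` is the law of `X`, which has finite support because `Ω` is finite;
values of probability `0` contribute `0` to the sum. -/
noncomputable def shannonEntropy {Ω : Type*} [Finite Ω] {α : Type*} (P : PMF Ω) (X : Ω → α) : ℝ :=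
  ∑ᶠ x : α, (P.map X x).toReal * Real.logb 2 (1 / (P.map X x).toReal)

namespace Polymatroid

/-- A polymatroid is entropic if it is `A ↦ H(X_A)` for a family `(X_i)`, `i ∈ E`, of random
variables on a finite probability space. Since such a space and the sets of attained values are
finite, it is no restriction to take them in `Type`. -/
def IsEntropic {E : Type*} (h : Polymatroid E) : Prop :=
  ∃ (Ω : Type) (_ : Finite Ω) (P : PMF Ω) (V : E → Type) (X : (i : E) → Ω → V i),
    ∀ A : Set E, h.rank A = shannonEntropy P (fun (ω : Ω) (i : A) => X i ω)

/-- A polymatroid of finite type is almost entropic if it is the pointwise limit of a sequence of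
entropic polymatroids on the same ground set. -/
def IsAlmostEntropic {E : Type*} (f : Polymatroid E) : Prop :=
  f.IsFiniteType ∧
    ∃ h : ℕ → Polymatroid E, (∀ n, (h n).IsEntropic) ∧
      ∀ A : Set E, Tendsto (fun n => (h n).rank A) atTop (𝓝 (f.rank A))

end Polymatroid

/-- The combinatorial data of a partial Dowling geometry of rank `r` with generating set `S`
(a set with an involution `s ↦ s⁻¹`): a distinguished element `e` of `S` fixed by the involution,
and an identification of the ground set `E` with the disjoint union of an `r`-element set and of
one copy of `S` for every pair `i < j` of indices. -/
structure DowlingFrame (r : ℕ) (E S : Type*) [InvolutiveInv S] where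
  e : S
  inv_e : e⁻¹ = e
  ground : Fin r ⊕ ({p : Fin r × Fin r // p.1 < p.2} × S) ≃ E

namespace DowlingFrame

/-- The element `b_i` of the distinguished basis. -/
def b {r : ℕ} {E S : Type*} [InvolutiveInv S] (D : DowlingFrame r E S) (i : Fin r) : E :=
  D.ground (Sum.inl i)

/-- The element `s_{i,j}` for `i ≠ j`: for `i < j` it is the element `s` of the copy of `S` with
index `(i, j)`, and for `j < i` it is `(s⁻¹)_{j,i}`. -/
def elt {r : ℕ} {E S : Type*} [InvolutiveInv S] (D : DowlingFrame r E S) (s : S) (i j : Fin r)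
    (hij : i ≠ j) : E :=
  if h : i < j then D.ground (Sum.inr (⟨(i, j), h⟩, s))
  else D.ground (Sum.inr (⟨(j, i), lt_of_le_of_ne (not_lt.mp h) hij.symm⟩, s⁻¹))

end DowlingFrame

/-- A partial Dowling geometry `(E, f, S)` of rank `r`. -/
structure PartialDowlingGeometry (r : ℕ) (E S : Type*) [InvolutiveInv S] extends
    DowlingFrame r E S where
  f : Polymatroid E
  rank_basis : ∀ A : Set (Fin r), f.rank (toDowlingFrame.b '' A) = A.ncard
  mem_cl : ∀ (s : S) (i j : Fin r) (hij : i ≠ j),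
    toDowlingFrame.elt s i j hij ∈ f.cl {toDowlingFrame.b i, toDowlingFrame.b j}
  rank_elt : ∀ (s : S) (i j : Fin r) (hij : i ≠ j), f.rank {toDowlingFrame.elt s i j hij} = 1
  rank_b_elt : ∀ (s : S) (i j : Fin r) (hij : i ≠ j),
    f.rank {toDowlingFrame.b i, toDowlingFrame.elt s i j hij} = 2
  coherence : ∀ (s : S) (i j k : Fin r) (hij : i ≠ j) (hjk : j ≠ k) (hki : k ≠ i),
    f.rank {toDowlingFrame.elt s i j hij, toDowlingFrame.elt s⁻¹ j k hjk,
      toDowlingFrame.elt e k i hki} = 2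

namespace PartialDowlingGeometry

/-- `(s, s', s'')` is a relator if `f(s_{i,j}, s'_{j,k}, s''_{k,i}) = 2` for all distinct
`i, j, k`. -/
def IsRelator {r : ℕ} {E S : Type*} [InvolutiveInv S] (G : PartialDowlingGeometry r E S)
    (s s' s'' : S) : Prop :=
  ∀ (i j k : Fin r) (hij : i ≠ j) (hjk : j ≠ k) (hki : k ≠ i),
    G.f.rank {G.elt s i j hij, G.elt s' j k hjk, G.elt s'' k i hki} = 2

/-- `t` is a geometric product of `s` and `s'`. -/
def IsGeometricProduct {r : ℕ} {E S : Type*} [InvolutiveInv S] (G : PartialDowlingGeometry r E S)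
    (s s' t : S) : Prop :=
  G.IsRelator s s' t⁻¹

end PartialDowlingGeometry

/-! By submodularity, polymatroid lines behave here as in a projective plane. The line through `b k`
and `b i` and the transversal line spanned by `s_{i,j}`, `s'_{j,k}` together have rank at least 3,
so they share rank at most 1. Two points on both are therefore parallel (`rank_pair_eq_one`), which
gives uniqueness of products. Conversely, coherence carries parallelism from one position to another
(`ParallelAt.change_left`), and parallel points are interchangeable in every relator. -/

theorem insert_rotate {α : Type*} (x y z : α) : ({x, y, z} : Set α) = {y, z, x} := by
  rw [Set.insert_comm, Set.pair_comm]

namespace Polymatroid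

theorem rank_add_rank_le {E : Type*} (f : Polymatroid E) {A B C D : Set E}
    (hD : D ⊆ A ∪ B) (hC : C ⊆ A ∩ B) : f.rank D + f.rank C ≤ f.rank A + f.rank B :=
  (add_le_add (f.rank_mono _ _ hD) (f.rank_mono _ _ hC)).trans (f.rank_submodular A B)

/-- A point may be replaced by a parallel one without increasing the rank of a set. -/
theorem rank_insert_le_of_parallel {E : Type*} (f : Polymatroid E) {x y : E}
    (hxy : f.rank {x, y} ≤ f.rank {x}) (A : Set E) :
    f.rank (insert y A) ≤ f.rank (insert x A) := by
  have h := f.rank_add_rank_le (A := insert x A) (B := {x, y}) (C := {x}) (D := insert y A)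
    (by intro z; simp; tauto) (by intro z; simp; tauto)
  linarith

end Polymatroid

theorem DowlingFrame.elt_inv {r : ℕ} {E S : Type*} [InvolutiveInv S] (D : DowlingFrame r E S)
    (s : S) (i j : Fin r) (hij : i ≠ j) : D.elt s⁻¹ i j hij = D.elt s j i hij.symm := by
  rcases lt_or_gt_of_ne hij with h | h
  · simp [elt, h, h.not_gt]
  · simp [elt, h, h.not_gt]

namespace PartialDowlingGeometry

variable {r : ℕ} {E S : Type*} [InvolutiveInv S] (G : PartialDowlingGeometry r E S)

theorem rank_b (i : Fin r) : G.f.rank {G.b i} = 1 := by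
  simpa using G.rank_basis {i}

theorem rank_b_b {i j : Fin r} (hij : i ≠ j) : G.f.rank {G.b i, G.b j} = 2 := by
  have h := G.rank_basis {i, j}
  rw [Set.image_pair, Set.ncard_pair hij] at h
  exact_mod_cast h

theorem rank_b_b_b {i j k : Fin r} (hij : i ≠ j) (hjk : j ≠ k) (hki : k ≠ i) :
    G.f.rank {G.b i, G.b j, G.b k} = 3 := by
  have h := G.rank_basis {i, j, k}
  rw [Set.image_insert_eq, Set.image_pair,
    Set.ncard_insert_of_notMem (by simp [hij, hki.symm]), Set.ncard_pair hjk] at h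
  norm_num at h
  exact h

theorem rank_b_b_elt (s : S) {i j : Fin r} (hij : i ≠ j) :
    G.f.rank {G.b i, G.b j, G.elt s i j hij} = 2 := by
  have h : G.f.rank {G.b i, G.b j} = G.f.rank ({G.b i, G.b j} ∪ {G.elt s i j hij}) :=
    G.mem_cl s i j hij
  rw [G.rank_b_b hij] at h
  rw [h]
  congr 1
  ext z
  simp
  tauto

/-- Two exchanges starting from the independent triple `b i`, `b j`, `b k`: `s'_{j,k}` spans `b k`
together with `b j`, and then `s_{i,j}` spans `b j` together with `b i`. -/
theorem three_le_rank_b_elt_elt (s s' : S) {i j k : Fin r} (hij : i ≠ j) (hjk : j ≠ k)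
    (hki : k ≠ i) : 3 ≤ G.f.rank {G.b i, G.elt s i j hij, G.elt s' j k hjk} := by
  have h₁ := G.f.rank_add_rank_le
    (A := {G.b i, G.b j, G.elt s i j hij, G.elt s' j k hjk})
    (B := {G.b j, G.b k, G.elt s' j k hjk}) (C := {G.b j, G.elt s' j k hjk})
    (D := {G.b i, G.b j, G.b k})
    (by intro z; simp; tauto) (by intro z; simp; tauto)
  have h₂ := G.f.rank_add_rank_le
    (A := {G.b i, G.elt s i j hij, G.elt s' j k hjk})
    (B := {G.b i, G.b j, G.elt s i j hij}) (C := {G.b i, G.elt s i j hij})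
    (D := {G.b i, G.b j, G.elt s i j hij, G.elt s' j k hjk})
    (by intro z; simp; tauto) (by intro z; simp; tauto)
  rw [G.rank_b_b_b hij hjk hki, G.rank_b_b_elt, G.rank_b_elt] at h₁
  rw [G.rank_b_b_elt, G.rank_b_elt] at h₂
  linarith

theorem two_le_rank_elt_elt (s s' : S) {i j k : Fin r} (hij : i ≠ j) (hjk : j ≠ k)
    (hki : k ≠ i) : 2 ≤ G.f.rank {G.elt s i j hij, G.elt s' j k hjk} := by
  have h := G.f.rank_add_rank_le (A := {G.elt s i j hij, G.elt s' j k hjk}) (B := {G.b i})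
    (C := ∅) (D := {G.b i, G.elt s i j hij, G.elt s' j k hjk})
    (by intro z; simp) (Set.empty_subset _)
  rw [G.f.rank_empty, G.rank_b] at h
  linarith [G.three_le_rank_b_elt_elt s s' hij hjk hki]

theorem one_le_rank_pair (t t' : S) {i j : Fin r} (hij : i ≠ j) :
    1 ≤ G.f.rank {G.elt t i j hij, G.elt t' i j hij} := by
  rw [← G.rank_elt t i j hij]
  exact G.f.rank_mono _ _ (by simp)

/-- Two points of the line through `b k` and `b i` that lie on a common transversal line
are parallel. -/
theorem rank_pair_eq_one {s s' t t' : S} {i j k : Fin r} (hij : i ≠ j) (hjk : j ≠ k)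
    (hki : k ≠ i)
    (ht : G.f.rank {G.elt s i j hij, G.elt s' j k hjk, G.elt t k i hki} ≤ 2)
    (ht' : G.f.rank {G.elt s i j hij, G.elt s' j k hjk, G.elt t' k i hki} ≤ 2) :
    G.f.rank {G.elt t k i hki, G.elt t' k i hki} = 1 := by
  have h₁ := G.f.rank_add_rank_le
    (A := {G.elt s i j hij, G.elt s' j k hjk, G.elt t k i hki})
    (B := {G.elt s i j hij, G.elt s' j k hjk, G.elt t' k i hki})
    (C := {G.elt s i j hij, G.elt s' j k hjk})
    (D := {G.elt s i j hij, G.elt s' j k hjk, G.elt t k i hki, G.elt t' k i hki})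
    (by intro z; simp; tauto) (by intro z; simp; tauto)
  have h₂ := G.f.rank_add_rank_le
    (A := {G.b k, G.b i, G.elt t k i hki}) (B := {G.b k, G.b i, G.elt t' k i hki})
    (C := {G.b k, G.b i}) (D := {G.b k, G.b i, G.elt t k i hki, G.elt t' k i hki})
    (by intro z; simp; tauto) (by intro z; simp; tauto)
  -- The first two sets have rank at most 2 by `h₁` and `h₂`, while their union has rank at least 3;
  -- this leaves at most 1 for the common pair.
  have h₃ := G.f.rank_add_rank_le
    (A := {G.elt s i j hij, G.elt s' j k hjk, G.elt t k i hki, G.elt t' k i hki})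
    (B := {G.b k, G.b i, G.elt t k i hki, G.elt t' k i hki})
    (C := {G.elt t k i hki, G.elt t' k i hki})
    (D := {G.b i, G.elt s i j hij, G.elt s' j k hjk})
    (by intro z; simp; tauto) (by intro z; simp; tauto)
  rw [G.rank_b_b hki, G.rank_b_b_elt, G.rank_b_b_elt] at h₂
  linarith [G.two_le_rank_elt_elt s s' hij hjk hki, G.one_le_rank_pair t t' hki,
    G.three_le_rank_b_elt_elt s s' hij hjk hki]

/-- `t` and `t'` are parallel in position `(i, j)`. -/
def ParallelAt (t t' : S) (i j : Fin r) : Prop :=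
  ∃ hij : i ≠ j, G.f.rank {G.elt t i j hij, G.elt t' i j hij} = 1

variable {G}

theorem ParallelAt.inv {t t' : S} {i j : Fin r} (h : G.ParallelAt t t' i j) :
    G.ParallelAt t⁻¹ t'⁻¹ j i := by
  obtain ⟨hij, h⟩ := h
  exact ⟨hij.symm, by simpa only [DowlingFrame.elt_inv] using h⟩

theorem ParallelAt.of_inv {t t' : S} {i j : Fin r} (h : G.ParallelAt t⁻¹ t'⁻¹ i j) :
    G.ParallelAt t t' j i := by
  simpa using h.inv

/-- Replacing a point by a parallel one does not increase the rank of a set. -/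
theorem ParallelAt.rank_insert_le {t t' : S} {i j : Fin r} (hij : i ≠ j)
    (h : G.ParallelAt t t' i j) (A : Set E) :
    G.f.rank (insert (G.elt t' i j hij) A) ≤ G.f.rank (insert (G.elt t i j hij) A) :=
  G.f.rank_insert_le_of_parallel (by rw [G.rank_elt, h.2]) A

theorem ParallelAt.symm {t t' : S} {i j : Fin r} (h : G.ParallelAt t t' i j) :
    G.ParallelAt t' t i j :=
  ⟨h.1, by rw [Set.pair_comm]; exact h.2⟩

/-- By coherence and replacement of `t'_{i,j}` by `t_{i,j}`, both `t⁻¹_{j,k}` and `t'⁻¹_{j,k}` lie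
on the line of `e_{k,i}` and `t_{i,j}`. -/
theorem ParallelAt.change_left {t t' : S} {i j k : Fin r} (h : G.ParallelAt t t' i j)
    (hjk : j ≠ k) (hki : k ≠ i) : G.ParallelAt t t' k j := by
  have hij := h.1
  refine ParallelAt.of_inv ⟨hjk, G.rank_pair_eq_one (s := G.e) (s' := t) hki hij hjk ?_ ?_⟩
  · rw [insert_rotate, G.coherence t i j k hij hjk hki]
  · rw [insert_rotate, ← G.coherence t' i j k hij hjk hki]
    exact h.symm.rank_insert_le hij _

theorem ParallelAt.change_right {t t' : S} {i j k : Fin r} (h : G.ParallelAt t t' i j)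
    (hik : i ≠ k) (hkj : k ≠ j) : G.ParallelAt t t' i k :=
  (h.inv.change_left hik hkj).of_inv

theorem ParallelAt.all {t t' : S} {i j : Fin 4} {G : PartialDowlingGeometry 4 E S}
    (h : G.ParallelAt t t' i j) {k l : Fin 4} (hkl : k ≠ l) : G.ParallelAt t t' k l := by
  -- The path is `(i, j)`, `(m, j)`, `(m, l)`, `(k, l)`. Each move needs a new index distinct from
  -- both old ones, so `m` must avoid three indices; rank 4 leaves room for it.
  obtain ⟨m, hmi, hmj, hml⟩ : ∃ m : Fin 4, m ≠ i ∧ m ≠ j ∧ m ≠ l := by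
    have key : ∀ i j l : Fin 4, ∃ m : Fin 4, m ≠ i ∧ m ≠ j ∧ m ≠ l := by decide
    exact key i j l
  have h₁ : G.ParallelAt t t' m j := h.change_left hmj.symm hmi
  have h₂ : G.ParallelAt t t' m l := by
    by_cases hlj : l = j
    · exact hlj ▸ h₁
    · exact h₁.change_right hml hlj
  by_cases hkm : k = m
  · exact hkm ▸ h₂
  · exact h₂.change_left hkl.symm hkm

end PartialDowlingGeometry

theorem mainTheorem6 {E S : Type*} [InvolutiveInv S] (G : PartialDowlingGeometry 4 E S)
    (hG : G.f.IsAlmostEntropic) (s s' : S) :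
    (∀ t t' : S, G.IsGeometricProduct s s' t → G.IsGeometricProduct s s' t' →
      ∀ (i j : Fin 4) (hij : i ≠ j), G.f.rank {G.elt t i j hij, G.elt t' i j hij} = 1) ∧
    (∀ t t' : S, G.IsGeometricProduct s s' t →
      (∃ (i j : Fin 4) (hij : i ≠ j), G.f.rank {G.elt t i j hij, G.elt t' i j hij} = 1) →
      G.IsGeometricProduct s s' t' ∧
        ∀ (k l : Fin 4) (hkl : k ≠ l), G.f.rank {G.elt t k l hkl, G.elt t' k l hkl} = 1) := by
  refine ⟨fun t t' ht ht' i j hij => ?_, ?_⟩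
  · obtain ⟨k, hik, hjk⟩ : ∃ k : Fin 4, i ≠ k ∧ j ≠ k := by
      clear hij; revert i j; decide
    -- The relators contain the inverses, so the common transversal through `s_{i,k}` and `s'_{k,j}`
    -- compares `t⁻¹` and `t'⁻¹` at `(j, i)`.
    have h : G.ParallelAt t⁻¹ t'⁻¹ j i :=
      ⟨hij.symm, G.rank_pair_eq_one hik hjk.symm hij.symm
        (ht i k j hik hjk.symm hij.symm).le (ht' i k j hik hjk.symm hij.symm).le⟩
    exact h.of_inv.2
  · rintro t t' ht ⟨i, j, hij, h⟩
    have hpar : G.ParallelAt t t' i j := ⟨hij, h⟩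
    refine ⟨fun i j k hij hjk hki => le_antisymm ?_ ?_, fun k l hkl => (hpar.all hkl).2⟩
    · have hle := (hpar.all hki.symm).inv.rank_insert_le hki
        {G.elt s i j hij, G.elt s' j k hjk}
      rw [insert_rotate, insert_rotate (G.elt t⁻¹ k i hki), ht i j k hij hjk hki] at hle
      exact hle
    · exact (G.two_le_rank_elt_elt s s' hij hjk hki).trans
        (G.f.rank_mono _ _ (by intro z; simp; tauto))
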